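/- For a real number $B>0$ let $\mathbb P^n(\mathbb Q,B)$ be the set of rational points of height $\le B$ in $\mathbb P^n$, that is, of points of $\mathbb P^n(\mathbb Q)$ that can be written in homogeneous integer coordinates $(x_0,\dots,x_n)$ with $|x_0|,\dots,|x_n|\le B$. A $k$-plane is a $k$-dimensional linear subspace of $\mathbb P^n$ defined over $\mathbb Q$. Let $n\ge 1$ and $0\le k\le n$ be integers. (1) There is a constant $c>0$ depending only on $n$ and $k$ such that for every real $B>0$ there are at most $cB^{\frac{(n+1)(n-k)}{n}}$ $k$-planes in $\mathbb P^n$ that jointly contain all points of $\mathbb P^n(\mathbb Q,B)$. (2) If $k<n$, then the exponent $\frac{n}{n+1}$ of $d$ in the bound $cd^{\frac{n}{n+1}}B^{k+1}$, conjectured for the number of rational points of height $\le B$ on a projective variety of degree $d$ and pure dimension $k$ in $\mathbb P^n$, cannot be lowered, already for unions of $k$-planes: for every real $\alpha<\frac{n}{n+1}$ and every real $c$ there are a real $B\ge 1$, an integer $d\ge 1$ and $d$ distinct $k$-planes in $\mathbb P^n$ that jointly contain more than $cd^{\alpha}B^{k+1}$ points of $\mathbb P^n(\mathbb Q,B)$.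 -/

import Mathlib

open scoped LinearAlgebra.Projectivization

/-- The rational points of projective `n`-space. -/
abbrev ProjSpace (n : ℕ) : Type := ℙ ℚ (Fin (n + 1) → ℚ)

/-- The rational points of height at most `B`: those having some homogeneous integer
coordinates `(x₀, …, xₙ)` with `|xᵢ| ≤ B` for all `i`. -/
def pointsOfHeightLE (n : ℕ) (B : ℝ) : Set (ProjSpace n) :=
  {P | ∃ (x : Fin (n + 1) → ℤ) (hx : (fun i => (x i : ℚ)) ≠ 0),
    Projectivization.mk ℚ (fun i => (x i : ℚ)) hx = P ∧ ∀ i, |(x i : ℝ)| ≤ B}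

/-- A `k`-plane: a linear subspace of projective `n`-space of projective dimension `k`, i.e. one
whose affine cone is a vector subspace of dimension `k + 1`. -/
def IsPlane {n : ℕ} (k : ℕ) (L : Projectivization.Subspace ℚ (Fin (n + 1) → ℚ)) : Prop :=
  Module.finrank ℚ L.submodule = k + 1

/-!
# Covering the rational points of bounded height by `k`-planes

Let `x` be the integer coordinate vector of a point of height at most `M`. The integer vectors
orthogonal to `x` form a lattice of rank `n` and determinant `O(M)`, so by Minkowski's second
theorem its successive minima have product `O(M)`, and the first `n - k` of them have product
`O(M ^ ((n - k) / n))`. Vectors realizing these minima cut out a `k`-plane through the point, so it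
suffices to count the rational spans of `n - k` independent integer vectors with bounded product of
sizes.

The bound on the minima is `two_pow_sum_minimumExponent_le`. Two counts of the small relations of
`x` are compared: a lower bound from the pigeonhole principle (`two_pow_le_card_relationBox`) and an
upper bound from reduction modulo an integer of the size of the ratio of consecutive minima
(`card_relationBox_le`).
No volumes or real lattices are needed.

The number of spans of vectors with product of sizes at most `X` in dimension `n + 1` is
`O(X ^ (n + 1))`. Counting tuples of vectors would lose logarithms. They are avoided by the
observation that the last vector may be changed by multiples of the first one without changing the
span (`ncard_spansOfSize_succ_le`). This saves the ratio of the two sizes, which makes the sum over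
all dyadic shapes geometric (`card_spansOfTotalSize_le`).

For the optimality of the exponent, take all points of height at most `N`: there are at least
`N ^ (n + 1) / 4` of them (`pow_le_four_mul_ncard_pointsOfHeightLE`), they are covered by
`d = O(N ^ ((n + 1) * (n - k) / n))` planes, and for the exponent `n / (n + 1)` the quantity
`d ^ (n / (n + 1)) * N ^ (k + 1)` is exactly of order `N ^ (n + 1)`.
-/

/-! ### Counting small integer relations -/

/-- The inclusion of `ℤ ^ N` in `ℚ ^ N`. -/
def ratVec (N : ℕ) : (Fin N → ℤ) →ₗ[ℤ] (Fin N → ℚ) :=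
  (Int.castAddHom ℚ).toIntLinearMap.compLeft (Fin N)

theorem ratVec_apply {N : ℕ} (v : Fin N → ℤ) (i : Fin N) : ratVec N v i = (v i : ℚ) := rfl

theorem ratVec_injective (N : ℕ) : Function.Injective (ratVec N) := fun v w h => by
  funext i
  have := congrFun h i
  simpa only [ratVec_apply, Int.cast_inj] using this

/-- An integral basis of the lattice spanned by `s` stays linearly independent over `ℚ`. -/
theorem finrank_int_span_le_finrank_rat_span {N : ℕ} (s : Set (Fin N → ℤ)) :
    Module.finrank ℤ (Submodule.span ℤ s) ≤
      Module.finrank ℚ (Submodule.span ℚ (ratVec N '' s)) := by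
  set G := Submodule.span ℤ s
  let b := Module.Free.chooseBasis ℤ G
  have hli : LinearIndependent ℤ (fun i => ratVec N (b i : Fin N → ℤ)) := by
    have := b.linearIndependent.map' ((ratVec N).comp G.subtype) (by
      rw [LinearMap.ker_eq_bot]
      exact (ratVec_injective N).comp G.injective_subtype)
    exact this
  rw [LinearIndependent.iff_fractionRing ℤ ℚ] at hli
  have hcard := finrank_span_eq_card hli
  rw [Module.finrank_eq_card_chooseBasisIndex, ← hcard]
  apply Submodule.finrank_mono
  rw [Submodule.span_le]
  rintro _ ⟨i, rfl⟩
  have hG : G ≤ ((Submodule.span ℚ (ratVec N '' s)).restrictScalars ℤ).comap (ratVec N) :=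
    Submodule.span_le.2 fun v hv => Submodule.subset_span ⟨v, hv, rfl⟩
  exact hG (b i).2

/-- The integer vectors all of whose coordinates have absolute value less than `2 ^ e`. -/
noncomputable def dyadicBox (N e : ℕ) : Finset (Fin N → ℤ) :=
  Fintype.piFinset fun _ => Finset.Ioo (-(2 : ℤ) ^ e) (2 ^ e)

theorem mem_dyadicBox {N e : ℕ} {v : Fin N → ℤ} :
    v ∈ dyadicBox N e ↔ ∀ i, |v i| < 2 ^ e := by
  simp [dyadicBox, abs_lt]

theorem card_dyadicBox_le (N e : ℕ) : (dyadicBox N e).card ≤ 2 ^ (N * (e + 1)) := by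
  have h : (Finset.Ioo (-(2 : ℤ) ^ e) (2 ^ e)).card ≤ 2 ^ (e + 1) := by
    rw [Int.card_Ioo, Int.toNat_le]
    push_cast
    rw [pow_succ]
    linarith
  rw [dyadicBox, Fintype.card_piFinset, Finset.prod_const, Finset.card_univ, Fintype.card_fin,
    mul_comm N, pow_mul]
  exact Nat.pow_le_pow_left h N

/-- The integer linear relations of `x` whose coefficients have absolute value less than
`2 ^ e`. -/
noncomputable def relationBox {N : ℕ} (x : Fin N → ℤ) (e : ℕ) : Finset (Fin N → ℤ) :=
  {v ∈ dyadicBox N e | x ⬝ᵥ v = 0}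

theorem mem_relationBox {N e : ℕ} {x v : Fin N → ℤ} :
    v ∈ relationBox x e ↔ (∀ i, |v i| < 2 ^ e) ∧ x ⬝ᵥ v = 0 := by
  simp [relationBox, mem_dyadicBox]

theorem relationBox_zero {N : ℕ} (x : Fin N → ℤ) : relationBox x 0 = {0} := by
  ext v
  simp only [mem_relationBox, pow_zero, Int.abs_lt_one_iff, Finset.mem_singleton]
  constructor
  · exact fun h => funext h.1
  · rintro rfl
    simp

/-- The dimension of the rational span of the relations of `x` of size less than `2 ^ e`. -/
noncomputable def relationRank {N : ℕ} (x : Fin N → ℤ) (e : ℕ) : ℕ :=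
  Module.finrank ℚ (Submodule.span ℚ (ratVec N '' (relationBox x e : Set (Fin N → ℤ))))

theorem relationRank_zero {N : ℕ} (x : Fin N → ℤ) : relationRank x 0 = 0 := by
  rw [relationRank, relationBox_zero, Finset.coe_singleton, Set.image_singleton, map_zero,
    Submodule.span_zero_singleton, finrank_bot]

/-- Growth of the number of small relations: two relations that agree modulo
`m = 2 * 2 ^ (e - e')` in the lattice spanned by the relations of size less than `2 ^ e` differ by
`m` times a relation of size less than `2 ^ e'`, and there are at most `m ^ i` classes. -/
theorem card_relationBox_le {N : ℕ} (x : Fin N → ℤ) {e e' i : ℕ} (he : e' ≤ e)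
    (hi : relationRank x e ≤ i) :
    (relationBox x e).card ≤ 2 ^ ((e - e' + 1) * i) * (relationBox x e').card := by
  classical
  set G := Submodule.span ℤ (relationBox x e : Set (Fin N → ℤ)) with hG
  let b := Module.Free.chooseBasis ℤ G
  set m : ℕ := 2 ^ (e - e' + 1) with hm
  have hm0 : 0 < m := by positivity
  have hsub : ∀ v ∈ relationBox x e, v ∈ G := fun v hv => Submodule.subset_span hv
  have hGx : ∀ v ∈ G, x ⬝ᵥ v = 0 := by
    intro v hv
    induction hv using Submodule.span_induction with
    | mem v hv => exact (mem_relationBox.1 (by exact_mod_cast hv)).2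
    | zero => simp
    | add v w _ _ h1 h2 => rw [dotProduct_add, h1, h2, add_zero]
    | smul c v _ h => rw [dotProduct_smul, h, smul_zero]
  have : NeZero m := ⟨hm0.ne'⟩
  let f : (Fin N → ℤ) → (Module.Free.ChooseBasisIndex ℤ G → ZMod m) := fun v j =>
    if hv : v ∈ G then ((b.repr ⟨v, hv⟩ j : ℤ) : ZMod m) else 0
  have hfib : ∀ a ∈ (relationBox x e).image f,
      ((relationBox x e).filter fun v => f v = a).card ≤ (relationBox x e').card := by
    intro a ha
    obtain ⟨w, hw, rfl⟩ := Finset.mem_image.1 ha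
    have hdiv : ∀ v ∈ (relationBox x e).filter (fun v => f v = f w),
        ∃ u ∈ relationBox x e', v = w + (m : ℤ) • u := by
      intro v hv
      obtain ⟨hv, hvw⟩ := Finset.mem_filter.1 hv
      have hcong : ∀ j, (m : ℤ) ∣ b.repr ⟨v, hsub v hv⟩ j - b.repr ⟨w, hsub w hw⟩ j := by
        intro j
        have := congrFun hvw j
        simp only [f, dif_pos (hsub v hv), dif_pos (hsub w hw)] at this
        rw [← ZMod.intCast_zmod_eq_zero_iff_dvd] 
        push_cast
        rw [this, sub_self]
      choose c hc using hcong
      let u : G := ∑ j, c j • b j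
      have hu : (⟨v, hsub v hv⟩ : G) = ⟨w, hsub w hw⟩ + (m : ℤ) • u := by
        apply b.repr.injective
        ext j
        simp only [u, map_add, map_smul, map_sum, Finsupp.add_apply, Finsupp.smul_apply,
          Module.Basis.repr_self, Finsupp.coe_finsetSum, Finset.sum_apply, smul_eq_mul]
        have hs : ∑ i, c i * (Finsupp.single i (1 : ℤ)) j = c j := by
          rw [Finset.sum_eq_single j]
          · simp
          · intro i _ hij
            simp [hij]
          · simp
        rw [hs, ← hc j]
        ring
      have hu' : v = w + (m : ℤ) • (u : Fin N → ℤ) := congrArg Subtype.val hu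
      refine ⟨u, mem_relationBox.2 ⟨fun i => ?_, hGx _ u.2⟩, hu'⟩
      have h1 := (mem_relationBox.1 hv).1 i
      have h2 := (mem_relationBox.1 hw).1 i
      have h3 : v i - w i = (m : ℤ) * (u : Fin N → ℤ) i := by
        have := congrFun hu' i
        simp only [Pi.add_apply, Pi.smul_apply, smul_eq_mul] at this
        linarith
      have h4 : (m : ℤ) * |(u : Fin N → ℤ) i| < m * 2 ^ e' := by
        have h5 : (m : ℤ) * 2 ^ e' = 2 * 2 ^ e := by
          rw [hm]
          push_cast
          rw [← pow_add, ← pow_succ']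
          congr 1
          omega
        have h6 : (m : ℤ) * |(u : Fin N → ℤ) i| = |v i - w i| := by
          rw [h3, abs_mul, Nat.abs_cast]
        rw [h5, h6]
        have := abs_sub (v i) (w i)
        linarith
      exact lt_of_mul_lt_mul_left h4 (by positivity)
    calc _ ≤ ((relationBox x e').image fun u => w + (m : ℤ) • u).card := by
          apply Finset.card_le_card
          intro v hv
          obtain ⟨u, hu, rfl⟩ := hdiv v hv
          exact Finset.mem_image_of_mem _ hu
      _ ≤ _ := Finset.card_image_le
  calc (relationBox x e).card ≤ (relationBox x e').card * ((relationBox x e).image f).card :=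
        Finset.card_le_mul_card_image _ _ hfib
    _ ≤ (relationBox x e').card * m ^ i := by
        gcongr
        refine (Finset.card_le_univ _).trans ?_
        rw [Fintype.card_fun, ZMod.card, ← Module.finrank_eq_card_chooseBasisIndex]
        exact Nat.pow_le_pow_right hm0
          ((finrank_int_span_le_finrank_rat_span _).trans hi)
    _ = _ := by rw [mul_comm, hm, pow_mul]

/-- Pigeonhole: the `2 ^ (e * (n + 1))` vectors `y` with coordinates in `[0, 2 ^ e)` take few
values `x ⬝ᵥ y`, and the difference of two of them with the same value is a relation. -/
theorem two_pow_le_card_relationBox {n M : ℕ} (hM : 1 ≤ M) {x : Fin (n + 1) → ℤ}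
    (hx : ∀ i, |x i| ≤ M) (e : ℕ) :
    2 ^ (n * e) ≤ 3 * (n + 1) * M * (relationBox x e).card := by
  classical
  let Y : Finset (Fin (n + 1) → ℤ) := Fintype.piFinset fun _ => Finset.Ico (0 : ℤ) (2 ^ e)
  have hYcard : Y.card = 2 ^ (n * e) * 2 ^ e := by
    have h2 : ((2 : ℤ) ^ e).toNat = 2 ^ e := by
      rw [show ((2 : ℤ) ^ e) = ((2 ^ e : ℕ) : ℤ) by push_cast; rfl, Int.toNat_natCast]
    rw [Fintype.card_piFinset, Finset.prod_const, Int.card_Ico, sub_zero, h2,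
      Finset.card_univ, Fintype.card_fin, pow_succ, ← pow_mul, mul_comm e]
  have hY : ∀ y ∈ Y, ∀ i, 0 ≤ y i ∧ y i < 2 ^ e := by
    intro y hy i
    simpa using Fintype.mem_piFinset.1 hy i
  set T : ℤ := (n + 1) * (M * 2 ^ e) with hT
  have himg : Y.image (fun y => x ⬝ᵥ y) ⊆ Finset.Icc (-T) T := by
    intro t ht
    obtain ⟨y, hy, rfl⟩ := Finset.mem_image.1 ht
    rw [Finset.mem_Icc, ← abs_le]
    calc |x ⬝ᵥ y| ≤ ∑ i, |x i * y i| := Finset.abs_sum_le_sum_abs _ _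
      _ ≤ ∑ _i : Fin (n + 1), (M : ℤ) * 2 ^ e := by
          apply Finset.sum_le_sum
          intro i _
          rw [abs_mul, abs_of_nonneg (hY y hy i).1]
          exact mul_le_mul (hx i) (hY y hy i).2.le (hY y hy i).1 (by positivity)
      _ = T := by simp [hT]
  have hfib : ∀ a ∈ Y.image (fun y => x ⬝ᵥ y),
      (Y.filter fun y => x ⬝ᵥ y = a).card ≤ (relationBox x e).card := by
    intro a ha
    obtain ⟨w, hw, rfl⟩ := Finset.mem_image.1 ha
    apply Finset.card_le_card_of_injOn (fun y => y - w)
    · intro y hy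
      obtain ⟨hy, hyw⟩ := Finset.mem_filter.1 (Finset.mem_coe.1 hy)
      refine mem_relationBox.2 ⟨fun i => ?_, by rw [dotProduct_sub, hyw, sub_self]⟩
      have h1 := hY y hy i
      have h2 := hY w hw i
      change |y i - w i| < 2 ^ e
      rw [abs_lt]
      constructor <;> linarith
    · intro y _ z _ h
      exact sub_left_injective h
  have hcard := Finset.card_le_mul_card_image Y _ hfib
  have hval : (Y.image fun y => x ⬝ᵥ y).card ≤ 3 * (n + 1) * M * 2 ^ e := by
    refine (Finset.card_le_card himg).trans ?_
    rw [Int.card_Icc, Int.toNat_le]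
    have h1 : (1 : ℤ) ≤ T := by
      have : (1 : ℤ) ≤ M := by exact_mod_cast hM
      have h2 : (1 : ℤ) ≤ 2 ^ e := one_le_pow₀ (by norm_num)
      have h3 : (1 : ℤ) ≤ M * 2 ^ e := one_le_mul_of_one_le_of_one_le this h2
      rw [hT]
      exact one_le_mul_of_one_le_of_one_le (by linarith [Int.natCast_nonneg n]) h3
    push_cast
    have : (3 : ℤ) * (n + 1) * M * 2 ^ e = 3 * T := by rw [hT]; ring
    rw [this]
    linarith
  rw [hYcard] at hcard
  have h2e : 0 < 2 ^ e := by positivity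
  refine Nat.le_of_mul_le_mul_right (hcard.trans ?_) h2e
  calc _ ≤ (relationBox x e).card * (3 * (n + 1) * M * 2 ^ e) := Nat.mul_le_mul_left _ hval
    _ = _ := by ring

/-! ### Successive minima of the lattice of relations -/

/-- Integer points have `n` independent relations. The count of small relations alone gives this:
if the rank stayed below `n`, there would be fewer small relations than the pigeonhole principle
provides. -/
theorem exists_lt_relationRank {n i M : ℕ} (hi : i < n) (hM : 1 ≤ M) {x : Fin (n + 1) → ℤ}
    (hx : ∀ j, |x j| ≤ M) : ∃ e, i < relationRank x (e + 1) := by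
  by_contra! h
  set K := 3 * (n + 1) * M
  -- The two counts differ by a factor `2 ^ (e + 1 - n) / K` at size `2 ^ e`, so `e = K + n + 1` is
  -- large enough for a contradiction.
  have h1 := two_pow_le_card_relationBox hM hx (K + n + 1)
  have h2 := card_relationBox_le x (Nat.zero_le (K + n + 1)) (h (K + n))
  rw [relationBox_zero, Finset.card_singleton, mul_one] at h2
  have h3 : 2 ^ (n * (K + n + 1)) ≤ K * 2 ^ ((K + n + 2) * (n - 1)) := by
    refine h1.trans (Nat.mul_le_mul_left _ (h2.trans ?_))
    apply Nat.pow_le_pow_right (by norm_num)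
    exact Nat.mul_le_mul (by omega) (by omega)
  obtain ⟨m, rfl⟩ : ∃ m, n = m + 1 := ⟨n - 1, by omega⟩
  have h4 : (m + 1) * (K + (m + 1) + 1) = K + 2 + (K + (m + 1) + 2) * (m + 1 - 1) := by
    rw [Nat.add_sub_cancel]
    ring
  rw [h4, pow_add] at h3
  have h5 := Nat.le_of_mul_le_mul_right h3 (by positivity)
  have h6 : K < 2 ^ K := Nat.lt_two_pow_self
  have h7 : 2 ^ K ≤ 2 ^ (K + 2) := Nat.pow_le_pow_right (by norm_num) (by omega)
  omega

/-- The `i`-th dyadic successive minimum (counted from `0`) of the lattice of relations of `x`: the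
least `e` for which the relations of size less than `2 ^ (e + 1)` span more than `i` dimensions. For
a nonzero integer point in dimension `n + 1` such `e` exist when `i < n`; otherwise the value `0` of
`sInf ∅` has no meaning. -/
noncomputable def minimumExponent {N : ℕ} (x : Fin N → ℤ) (i : ℕ) : ℕ :=
  sInf {e | i < relationRank x (e + 1)}

theorem relationRank_minimumExponent_le {N : ℕ} (x : Fin N → ℤ) (i : ℕ) :
    relationRank x (minimumExponent x i) ≤ i := by
  rcases h : minimumExponent x i with _ | e
  · rw [relationRank_zero]
    exact Nat.zero_le _
  · have : e ∉ {e | i < relationRank x (e + 1)} := Nat.notMem_of_lt_sInf (by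
      change e < minimumExponent x i
      omega)
    simpa using this

theorem lt_relationRank_minimumExponent {n i M : ℕ} (hi : i < n) (hM : 1 ≤ M)
    {x : Fin (n + 1) → ℤ} (hx : ∀ j, |x j| ≤ M) :
    i < relationRank x (minimumExponent x i + 1) :=
  Nat.sInf_mem (s := {e | i < relationRank x (e + 1)}) (exists_lt_relationRank hi hM hx)

theorem minimumExponent_le {n i j M : ℕ} (hij : i ≤ j) (hj : j < n) (hM : 1 ≤ M)
    {x : Fin (n + 1) → ℤ} (hx : ∀ j, |x j| ≤ M) :
    minimumExponent x i ≤ minimumExponent x j :=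
  Nat.sInf_le (hij.trans_lt (lt_relationRank_minimumExponent hj hM hx))

/-- With `λ j = 2 ^ minimumExponent x j`, there are at most a constant times
`λ i ^ i / (λ 0 * ⋯ * λ (i - 1))` relations of size less than `λ i`. In the induction the relations
of size less than `λ (i + 1)` have rank at most `i + 1`, so passing from `λ i` to `λ (i + 1)`
multiplies the count by at most a constant times `(λ (i + 1) / λ i) ^ (i + 1)`. -/
theorem card_relationBox_minimumExponent_le {n i M : ℕ} (hi : i < n) (hM : 1 ≤ M)
    {x : Fin (n + 1) → ℤ} (hx : ∀ j, |x j| ≤ M) :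
    (relationBox x (minimumExponent x i)).card *
      2 ^ (∑ j ∈ Finset.range i, minimumExponent x j) ≤
        2 ^ (i ^ 2 + i * minimumExponent x i) := by
  induction i with
  | zero =>
    have h := card_relationBox_le x (Nat.zero_le (minimumExponent x 0))
      (relationRank_minimumExponent_le x 0)
    rw [relationBox_zero, Finset.card_singleton] at h
    simpa using h
  | succ i ih =>
    have ih := ih (by omega)
    have hmono := minimumExponent_le (Nat.le_add_right i 1) hi hM hx
    have h := card_relationBox_le x hmono (relationRank_minimumExponent_le x (i + 1))
    rw [Finset.sum_range_succ, pow_add]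
    set f := minimumExponent x
    obtain ⟨d, hd⟩ := Nat.exists_eq_add_of_le hmono
    have hd' : f (i + 1) - f i = d := by omega
    rw [hd'] at h
    calc _ ≤ (2 ^ ((d + 1) * (i + 1)) * (relationBox x (f i)).card) *
          (2 ^ (∑ j ∈ Finset.range i, f j) * 2 ^ f i) := Nat.mul_le_mul_right _ h
      _ = 2 ^ ((d + 1) * (i + 1)) * 2 ^ f i *
          ((relationBox x (f i)).card * 2 ^ (∑ j ∈ Finset.range i, f j)) := by ring
      _ ≤ 2 ^ ((d + 1) * (i + 1)) * 2 ^ f i * 2 ^ (i ^ 2 + i * f i) :=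
          Nat.mul_le_mul_left _ ih
      _ ≤ _ := by
          rw [← pow_add, ← pow_add]
          apply Nat.pow_le_pow_right (by norm_num)
          rw [hd]
          nlinarith

/-- Form of the upper bound in Minkowski's second theorem for the first `q + 1` minima of the
lattice of relations of an integer point of height at most `M`. -/
theorem two_pow_sum_minimumExponent_le {n q M : ℕ} (hq : q < n) (hM : 1 ≤ M)
    {x : Fin (n + 1) → ℤ} (hx : ∀ j, |x j| ≤ M) :
    2 ^ (n * ∑ j ∈ Finset.range (q + 1), minimumExponent x j) ≤
      (3 * (n + 1) * M * 2 ^ q ^ 2) ^ (q + 1) := by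
  set f := minimumExponent x with hf
  obtain ⟨k, rfl⟩ : ∃ k, n = k + (q + 1) := ⟨n - (q + 1), by omega⟩
  set K := 3 * (k + (q + 1) + 1) * M
  have h1 := two_pow_le_card_relationBox hM hx (f q)
  have h2 := card_relationBox_minimumExponent_le hq hM hx
  rw [← hf] at h2
  set s := ∑ j ∈ Finset.range (q + 1), f j with hs
  have hs' : s = ∑ j ∈ Finset.range q, f j + f q := Finset.sum_range_succ _ _
  set s' := ∑ j ∈ Finset.range q, f j
  have h3 : 2 ^ (k * f q + s) ≤ K * 2 ^ q ^ 2 := by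
    refine Nat.le_of_mul_le_mul_right (c := 2 ^ (q * f q)) ?_ (by positivity)
    calc 2 ^ (k * f q + s) * 2 ^ (q * f q)
        = 2 ^ ((k + (q + 1)) * f q) * 2 ^ s' := by
          rw [← pow_add, ← pow_add, hs']
          congr 1
          ring
      _ ≤ K * (relationBox x (f q)).card * 2 ^ s' := Nat.mul_le_mul_right _ h1
      _ = K * ((relationBox x (f q)).card * 2 ^ s') := by ring
      _ ≤ K * 2 ^ (q ^ 2 + q * f q) := Nat.mul_le_mul_left _ h2
      _ = _ := by rw [pow_add]; ring
  have hsum : s ≤ (q + 1) * f q := by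
    have := Finset.sum_le_card_nsmul (Finset.range (q + 1)) f (f q) fun j hj =>
      minimumExponent_le (Nat.lt_succ_iff.1 (Finset.mem_range.1 hj)) hq hM hx
    simpa using this
  calc 2 ^ ((k + (q + 1)) * s) ≤ 2 ^ ((k * f q + s) * (q + 1)) := by
        apply Nat.pow_le_pow_right (by norm_num)
        have := Nat.mul_le_mul_left k hsum
        nlinarith
    _ = (2 ^ (k * f q + s)) ^ (q + 1) := pow_mul _ _ _
    _ ≤ _ := Nat.pow_le_pow_left h3 _

/-- Independent relations realizing the successive minima, chosen greedily. -/
theorem exists_linearIndependent_relations {n M : ℕ} (hM : 1 ≤ M) {x : Fin (n + 1) → ℤ}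
    (hx : ∀ j, |x j| ≤ M) (p : ℕ) (hp : p ≤ n) :
    ∃ b : Fin p → Fin (n + 1) → ℤ, LinearIndependent ℚ (fun j => ratVec (n + 1) (b j)) ∧
      ∀ j : Fin p, b j ∈ relationBox x (minimumExponent x j + 1) := by
  induction p with
  | zero => exact ⟨fun j => j.elim0, linearIndependent_empty_type, fun j => j.elim0⟩
  | succ p ih =>
    obtain ⟨b, hb, hbx⟩ := ih (by omega)
    have hlt := lt_relationRank_minimumExponent (Nat.lt_of_succ_le hp) hM hx
    obtain ⟨v, hv, hvb⟩ : ∃ v ∈ relationBox x (minimumExponent x p + 1),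
        ratVec (n + 1) v ∉ Submodule.span ℚ (Set.range fun j => ratVec (n + 1) (b j)) := by
      by_contra! h
      have hle : Submodule.span ℚ (ratVec (n + 1) ''
          (relationBox x (minimumExponent x p + 1) : Set (Fin (n + 1) → ℤ))) ≤
          Submodule.span ℚ (Set.range fun j => ratVec (n + 1) (b j)) := by
        rw [Submodule.span_le]
        rintro _ ⟨v, hv, rfl⟩
        exact h v hv
      have := Submodule.finrank_mono hle
      rw [finrank_span_eq_card hb, Fintype.card_fin] at this
      exact absurd hlt (not_lt.2 this)
    refine ⟨Fin.snoc b v, ?_, fun j => ?_⟩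
    · have : (fun j => ratVec (n + 1) ((Fin.snoc b v : Fin (p + 1) → Fin (n + 1) → ℤ) j)) =
          Fin.snoc (fun j => ratVec (n + 1) (b j)) (ratVec (n + 1) v) := by
        funext j
        refine Fin.lastCases ?_ (fun j => ?_) j <;> simp
      rw [this, linearIndependent_finSnoc]
      exact ⟨hb, hvb⟩
    · refine Fin.lastCases ?_ (fun j => ?_) j
      · simpa using hv
      · simpa using hbx j

/-! ### Counting rational spans of integer vectors -/

/-- The rational subspaces spanned by linearly independent integer vectors `b j` whose coordinates
are less than `2 ^ (e j + 1)` in absolute value. -/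
def spansOfSize (N : ℕ) {r : ℕ} (e : Fin r → ℕ) : Set (Submodule ℚ (Fin N → ℚ)) :=
  {W | ∃ b : Fin r → Fin N → ℤ, LinearIndependent ℚ (fun j => ratVec N (b j)) ∧
    (∀ j, b j ∈ dyadicBox N (e j + 1)) ∧
    Submodule.span ℚ (Set.range fun j => ratVec N (b j)) = W}

theorem spansOfSize_finite (N : ℕ) {r : ℕ} (e : Fin r → ℕ) : (spansOfSize N e).Finite := by
  apply ((Fintype.piFinset fun j => dyadicBox N (e j + 1)).finite_toSet.image fun b =>
    Submodule.span ℚ (Set.range fun j => ratVec N (b j))).subset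
  rintro W ⟨b, -, hb, rfl⟩
  exact ⟨b, by simpa using hb, rfl⟩

/-- Adding a last vector: the new span `W'` determines `W` and a class of vectors modulo `W`, and
each class has at least `2 ^ (e (last) - e 0)` members of the same order of size as the last
vector, because `W` contains a nonzero vector of size `2 ^ e 0`. -/
theorem ncard_spansOfSize_succ_le (N : ℕ) {q : ℕ} (e : Fin (q + 1 + 1) → ℕ) (he : Monotone e) :
    (spansOfSize N e).ncard * 2 ^ (e (Fin.last _) - e 0) ≤
      (spansOfSize N (fun j : Fin (q + 1) => e j.castSucc)).ncard *
        2 ^ (N * (e (Fin.last _) + 3)) := by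
  classical
  set l := e (Fin.last _) with hl
  set A := (spansOfSize_finite N (fun j : Fin (q + 1) => e j.castSucc)).toFinset with hA
  set B := (spansOfSize_finite N e).toFinset with hB
  rw [Set.ncard_eq_toFinset_card _ (spansOfSize_finite N e),
    Set.ncard_eq_toFinset_card _ (spansOfSize_finite N (fun j : Fin (q + 1) => e j.castSucc)),
    ← hA, ← hB]
  have hpar : ∀ W' ∈ B, ∃ W ∈ A, ∃ v ∈ dyadicBox N (l + 1),
      W' = W ⊔ Submodule.span ℚ {ratVec N v} := by
    intro W' hW'
    obtain ⟨b, hli, hb, rfl⟩ := (spansOfSize_finite N e).mem_toFinset.1 hW'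
    refine ⟨Submodule.span ℚ (Set.range fun j : Fin (q + 1) => ratVec N (b j.castSucc)),
      (Set.Finite.mem_toFinset _).2 ⟨fun j => b j.castSucc,
        hli.comp _ (Fin.castSucc_injective _), fun j => hb _, rfl⟩, b (Fin.last _), hb _, ?_⟩
    rw [← Submodule.span_union]
    congr 1
    ext w
    simp only [Set.mem_range, Set.union_singleton, Set.mem_insert_iff]
    constructor
    · rintro ⟨j, rfl⟩
      refine Fin.lastCases (Or.inl rfl) (fun j => Or.inr ⟨j, rfl⟩) j
    · rintro (rfl | ⟨j, rfl⟩)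
      · exact ⟨_, rfl⟩
      · exact ⟨_, rfl⟩
  have hvec : ∀ W ∈ A, ∃ a ∈ dyadicBox N (e 0 + 1), a ≠ 0 ∧ ratVec N a ∈ W := by
    intro W hW
    obtain ⟨b, hli, hb, rfl⟩ := (Set.Finite.mem_toFinset _).1 hW
    refine ⟨b 0, hb 0, ?_, Submodule.subset_span ⟨0, rfl⟩⟩
    intro h0
    exact hli.ne_zero 0 (by simp [h0])
  choose! par hparA v hv hW' using hpar
  choose! a ha ha0 haW using hvec
  have hmaps : ∀ z ∈ B ×ˢ Finset.range (2 ^ (l - e 0)),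
      (par z.1, v z.1 + (z.2 : ℤ) • a (par z.1)) ∈ A ×ˢ dyadicBox N (l + 2) := by
    rintro ⟨W', m⟩ hz
    obtain ⟨hW, hm⟩ := Finset.mem_product.1 hz
    refine Finset.mem_product.2 ⟨hparA _ hW, mem_dyadicBox.2 fun i => ?_⟩
    have h1 := mem_dyadicBox.1 (hv _ hW) i
    have h2 := mem_dyadicBox.1 (ha _ (hparA _ hW)) i
    have h3 : (m : ℤ) ≤ 2 ^ (l - e 0) := by exact_mod_cast (Finset.mem_range.1 hm).le
    have h4 : (2 : ℤ) ^ (l - e 0) * 2 ^ (e 0 + 1) = 2 ^ (l + 1) := by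
      rw [← pow_add]
      congr 1
      have := he (Fin.zero_le (Fin.last (q + 1)))
      omega
    have h5 : |(m : ℤ) * a (par W') i| ≤ 2 ^ (l + 1) := by
      rw [abs_mul, Nat.abs_cast, ← h4]
      exact mul_le_mul h3 h2.le (abs_nonneg _) (by positivity)
    calc |v W' i + (m : ℤ) * a (par W') i| ≤ |v W' i| + |(m : ℤ) * a (par W') i| := abs_add_le _ _
      _ < 2 ^ (l + 2) := by
        rw [pow_succ 2 (l + 1)]
        linarith
  have hinj : Set.InjOn (fun z : Submodule ℚ (Fin N → ℚ) × ℕ =>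
      (par z.1, v z.1 + (z.2 : ℤ) • a (par z.1)))
      (B ×ˢ Finset.range (2 ^ (l - e 0)) : Finset (Submodule ℚ (Fin N → ℚ) × ℕ)) := by
    -- Translating by a vector of `W` does not change the span of `W` and the last vector.
    have hrec : ∀ W' ∈ B, ∀ m : ℕ, W' =
        par W' ⊔ Submodule.span ℚ {ratVec N (v W' + (m : ℤ) • a (par W'))} := by
      intro W' hW m
      have hmem : (m : ℤ) • ratVec N (a (par W')) ∈ par W' :=
        zsmul_mem (haW _ (hparA _ hW)) _
      conv_lhs => rw [hW' W' hW]
      apply le_antisymm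
      · refine sup_le le_sup_left ?_
        rw [Submodule.span_singleton_le_iff_mem]
        have h1 : ratVec N (v W') =
            -((m : ℤ) • ratVec N (a (par W'))) + ratVec N (v W' + (m : ℤ) • a (par W')) := by
          rw [map_add, map_smul]
          abel
        rw [h1]
        exact Submodule.add_mem_sup (neg_mem hmem) (Submodule.mem_span_singleton_self _)
      · refine sup_le le_sup_left ?_
        rw [Submodule.span_singleton_le_iff_mem, map_add, map_smul, add_comm]
        exact Submodule.add_mem_sup hmem (Submodule.mem_span_singleton_self _)
    rintro ⟨W₁, m₁⟩ h₁ ⟨W₂, m₂⟩ h₂ h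
    have hW₁ := (Finset.mem_product.1 (Finset.mem_coe.1 h₁)).1
    have hW₂ := (Finset.mem_product.1 (Finset.mem_coe.1 h₂)).1
    obtain ⟨hp, hvv⟩ := Prod.mk.inj h
    simp only at hp hvv hW₁ hW₂
    have hWW : W₁ = W₂ := by
      rw [hrec W₁ hW₁ m₁, hrec W₂ hW₂ m₂, hvv, hp]
    subst hWW
    have h6 := add_left_cancel hvv
    have h7 := smul_left_injective ℤ (ha0 _ (hparA _ hW₁)) h6
    rw [Int.natCast_inj.1 h7]
  have hcard := Finset.card_le_card_of_injOn _ hmaps hinj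
  rw [Finset.card_product, Finset.card_product, Finset.card_range] at hcard
  exact hcard.trans (Nat.mul_le_mul_left _ (card_dyadicBox_le _ _))

/-- The gain `2 ^ ∑ (e j - e 0)` over the number of tuples of vectors makes the sum over all
dyadic shapes `e` with given `∑ e j` converge. -/
theorem ncard_spansOfSize_le (N : ℕ) {q : ℕ} (e : Fin (q + 1) → ℕ) (he : Monotone e) :
    (spansOfSize N e).ncard * 2 ^ (∑ j, (e j - e 0)) ≤
      2 ^ (3 * N * (q + 1)) * 2 ^ (N * ∑ j, e j) := by
  induction q with
  | zero =>
    have hsub : spansOfSize N e ⊆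
        (fun v => Submodule.span ℚ {ratVec N v}) '' (dyadicBox N (e 0 + 1)) := by
      rintro W ⟨b, -, hb, rfl⟩
      refine ⟨b 0, hb 0, ?_⟩
      have : (Set.range fun j => ratVec N (b j)) = {ratVec N (b 0)} := by
        ext w
        constructor
        · rintro ⟨j, rfl⟩
          rw [Fin.fin_one_eq_zero j, Set.mem_singleton_iff]
        · rintro rfl
          exact ⟨0, rfl⟩
      rw [this]
    have h1 := (Set.ncard_le_ncard hsub ((Finset.finite_toSet _).image _)).trans
      (Set.ncard_image_le (Finset.finite_toSet _))
    rw [Set.ncard_coe_finset] at h1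
    have h2 := h1.trans (card_dyadicBox_le _ _)
    have hD : ∑ j : Fin (0 + 1), (e j - e 0) = 0 :=
      Finset.sum_eq_zero fun j _ => by rw [Fin.fin_one_eq_zero j, Nat.sub_self]
    have hS : ∑ j : Fin (0 + 1), e j = e 0 := Fin.sum_univ_one _
    rw [hD, hS, pow_zero, mul_one]
    refine h2.trans ?_
    rw [← pow_add]
    apply Nat.pow_le_pow_right (by norm_num)
    nlinarith
  | succ q ih =>
    have ih := ih (fun j => e j.castSucc) (fun i j h => he (Fin.castSucc_le_castSucc_iff.2 h))
    have hstep := ncard_spansOfSize_succ_le N e he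
    rw [Fin.castSucc_zero] at ih
    rw [Fin.sum_univ_castSucc (fun j => e j - e 0), Fin.sum_univ_castSucc e, pow_add]
    set A := (spansOfSize N fun j : Fin (q + 1) => e j.castSucc).ncard
    set s := ∑ j : Fin (q + 1), e j.castSucc
    set D := ∑ j : Fin (q + 1), (e j.castSucc - e 0)
    set l := e (Fin.last (q + 1))
    calc _ = (spansOfSize N e).ncard * 2 ^ (l - e 0) * 2 ^ D := by ring
      _ ≤ A * 2 ^ (N * (l + 3)) * 2 ^ D := Nat.mul_le_mul_right _ hstep
      _ = A * 2 ^ D * 2 ^ (N * (l + 3)) := by ring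
      _ ≤ 2 ^ (3 * N * (q + 1)) * 2 ^ (N * s) * 2 ^ (N * (l + 3)) := Nat.mul_le_mul_right _ ih
      _ = _ := by
        rw [← pow_add, ← pow_add, ← pow_add]
        congr 1
        ring

/-! ### Covering by planes -/

/-- The projective subspace of the points orthogonal to `W` under the dot product. -/
noncomputable def orthogonalPlane {N : ℕ} (W : Submodule ℚ (Fin N → ℚ)) :
    Projectivization.Subspace ℚ (Fin N → ℚ) :=
  (W.map (dotProductEquiv ℚ (Fin N)).toLinearMap).dualCoannihilator.projectivization

theorem mk_mem_orthogonalPlane {N : ℕ} {W : Submodule ℚ (Fin N → ℚ)} {y : Fin N → ℚ}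
    (hy : y ≠ 0) : Projectivization.mk ℚ y hy ∈ orthogonalPlane W ↔ ∀ w ∈ W, w ⬝ᵥ y = 0 := by
  rw [orthogonalPlane, Submodule.mk_mem_projectivization_iff, Submodule.mem_dualCoannihilator]
  constructor
  · intro h w hw
    exact h _ (Submodule.mem_map_of_mem hw)
  · rintro h _ ⟨w, hw, rfl⟩
    exact h w hw

theorem isPlane_orthogonalPlane {k q : ℕ} {W : Submodule ℚ (Fin (k + (q + 1) + 1) → ℚ)}
    (hW : Module.finrank ℚ W = q + 1) : IsPlane k (orthogonalPlane W) := by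
  have h := Subspace.finrank_add_finrank_dualCoannihilator_eq
    (W.map (dotProductEquiv ℚ (Fin (k + (q + 1) + 1))).toLinearMap)
  rw [LinearEquiv.finrank_map_eq, hW, Module.finrank_fin_fun] at h
  have h2 : (orthogonalPlane W).submodule =
      (W.map (dotProductEquiv ℚ (Fin (k + (q + 1) + 1))).toLinearMap).dualCoannihilator :=
    OrderIso.apply_symm_apply _ _
  rw [IsPlane, h2]
  omega

theorem sum_range_two_pow_mul_le {N : ℕ} (hN : 1 ≤ N) (T : ℕ) :
    ∑ s ∈ Finset.range (T + 1), (2 : ℝ) ^ (N * s) ≤ 2 * 2 ^ (N * T) := by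
  induction T with
  | zero => simp
  | succ T ih =>
    rw [Finset.sum_range_succ]
    have : (2 : ℝ) * 2 ^ (N * T) ≤ 2 ^ (N * (T + 1)) := by
      rw [← pow_succ']
      exact pow_le_pow_right₀ (by norm_num) (by nlinarith)
    linarith

/-- The dyadic shape `e` with sum `s` and differences `e j - e 0 = d j`, where `d 0 = 0`. The
truncated subtraction and the division are exact whenever such a shape exists. -/
def dyadicShape {q : ℕ} (s : ℕ) (d : Fin (q + 1) → ℕ) (j : Fin (q + 1)) : ℕ :=
  (s - ∑ i, d i) / (q + 1) + d j

theorem dyadicShape_sum_sub {q : ℕ} {f : Fin (q + 1) → ℕ} (hf : Monotone f) :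
    dyadicShape (∑ j, f j) (fun j => f j - f 0) = f := by
  have h0 : ∀ j, f 0 ≤ f j := fun j => hf (Fin.zero_le j)
  have h1 : ∑ j, f j = ∑ j, (f j - f 0) + (q + 1) * f 0 := by
    calc ∑ j, f j = ∑ j, ((f j - f 0) + f 0) :=
          Finset.sum_congr rfl fun j _ => (Nat.sub_add_cancel (h0 j)).symm
      _ = _ := by simp [Finset.sum_add_distrib]
  funext j
  rw [dyadicShape, h1, Nat.add_sub_cancel_left, Nat.mul_div_cancel_left _ (Nat.succ_pos q)]
  exact Nat.add_sub_cancel' (h0 j)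

open Classical in
/-- The finitely many subspaces spanned by independent integer vectors whose dyadic sizes are
nondecreasing with sum at most `T`. -/
noncomputable def spansOfTotalSize (N q T : ℕ) : Finset (Submodule ℚ (Fin N → ℚ)) :=
  {z ∈ Finset.range (T + 1) ×ˢ
      Fintype.piFinset (fun _ : Fin (q + 1) => Finset.range (T + 1)) |
    Monotone (dyadicShape z.1 z.2) ∧ ∑ j, dyadicShape z.1 z.2 j = z.1 ∧ z.2 0 = 0}.biUnion
    fun z => (spansOfSize_finite N (dyadicShape z.1 z.2)).toFinset

theorem mem_spansOfTotalSize {N q T : ℕ} {f : Fin (q + 1) → ℕ} (hf : Monotone f)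
    (hT : ∑ j, f j ≤ T) {W : Submodule ℚ (Fin N → ℚ)} (hW : W ∈ spansOfSize N f) :
    W ∈ spansOfTotalSize N q T := by
  classical
  rw [spansOfTotalSize, Finset.mem_biUnion]
  refine ⟨(∑ j, f j, fun j => f j - f 0), ?_, ?_⟩
  · simp only [Finset.mem_filter, Finset.mem_product, Finset.mem_range, Fintype.mem_piFinset,
      dyadicShape_sum_sub hf]
    refine ⟨⟨by omega, fun j => ?_⟩, hf, trivial, Nat.sub_self _⟩
    have := Finset.single_le_sum (fun i _ => Nat.zero_le (f i)) (Finset.mem_univ j)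
    omega
  · rw [Set.Finite.mem_toFinset]
    simpa only [dyadicShape_sum_sub hf] using hW

theorem finrank_of_mem_spansOfTotalSize {N q T : ℕ} {W : Submodule ℚ (Fin N → ℚ)}
    (hW : W ∈ spansOfTotalSize N q T) : Module.finrank ℚ W = q + 1 := by
  classical
  obtain ⟨z, -, hz⟩ := Finset.mem_biUnion.1 hW
  obtain ⟨b, hb, -, rfl⟩ := (Set.Finite.mem_toFinset _).1 hz
  rw [finrank_span_eq_card hb, Fintype.card_fin]

/-- There is no logarithmic loss in the number of spans: the gain `2 ^ ∑ d j` for the shape with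
differences `d j` makes the sum over all shapes geometric. -/
theorem card_spansOfTotalSize_le {N : ℕ} (hN : 1 ≤ N) (q T : ℕ) :
    ((spansOfTotalSize N q T).card : ℝ) ≤
      2 ^ (3 * N * (q + 1)) * (2 * 2 ^ (N * T)) * 2 ^ (q + 1) := by
  classical
  set P := Finset.range (T + 1) ×ˢ Fintype.piFinset (fun _ : Fin (q + 1) => Finset.range (T + 1))
  set K : ℝ := 2 ^ (3 * N * (q + 1)) with hK
  have hterm : ∀ z ∈ P.filter (fun z => Monotone (dyadicShape z.1 z.2) ∧
      ∑ j, dyadicShape z.1 z.2 j = z.1 ∧ z.2 0 = 0),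
      (((spansOfSize_finite N (dyadicShape z.1 z.2)).toFinset.card : ℕ) : ℝ) ≤
        K * (2 ^ (N * z.1) * ∏ j, (1 / 2 : ℝ) ^ z.2 j) := by
    rintro ⟨s, d⟩ hz
    obtain ⟨-, hmono, hsum, hd⟩ := Finset.mem_filter.1 hz
    simp only at hmono hsum hd ⊢
    have h := ncard_spansOfSize_le N _ hmono
    have hsub : ∀ j, dyadicShape s d j - dyadicShape s d 0 = d j := by
      intro j
      rw [dyadicShape, dyadicShape, hd]
      omega
    rw [hsum, Finset.sum_congr rfl fun j _ => hsub j,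
      Set.ncard_eq_toFinset_card _ (spansOfSize_finite N (dyadicShape s d))] at h
    have h' : (((spansOfSize_finite N (dyadicShape s d)).toFinset.card : ℕ) : ℝ) * 2 ^ (∑ j, d j) ≤
        K * 2 ^ (N * s) := by
      rw [hK]
      exact_mod_cast h
    rw [Finset.prod_pow_eq_pow_sum, one_div, inv_pow, ← mul_assoc, ← div_eq_mul_inv,
      le_div_iff₀ (by positivity)]
    exact h'
  calc ((spansOfTotalSize N q T).card : ℝ)
      ≤ ∑ z ∈ P.filter (fun z => Monotone (dyadicShape z.1 z.2) ∧
          ∑ j, dyadicShape z.1 z.2 j = z.1 ∧ z.2 0 = 0),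
          (((spansOfSize_finite N (dyadicShape z.1 z.2)).toFinset.card : ℕ) : ℝ) := by
        rw [← Nat.cast_sum, Nat.cast_le]
        exact Finset.card_biUnion_le
    _ ≤ ∑ z ∈ P.filter (fun z => Monotone (dyadicShape z.1 z.2) ∧
          ∑ j, dyadicShape z.1 z.2 j = z.1 ∧ z.2 0 = 0),
          K * (2 ^ (N * z.1) * ∏ j, (1 / 2 : ℝ) ^ z.2 j) := Finset.sum_le_sum hterm
    _ ≤ ∑ z ∈ P, K * (2 ^ (N * z.1) * ∏ j, (1 / 2 : ℝ) ^ z.2 j) :=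
        Finset.sum_le_sum_of_subset_of_nonneg (Finset.filter_subset _ _)
          fun z _ _ => by positivity
    _ = K * (∑ s ∈ Finset.range (T + 1), 2 ^ (N * s)) *
          (∑ d ∈ Finset.range (T + 1), (1 / 2 : ℝ) ^ d) ^ (q + 1) := by
        rw [← Finset.mul_sum, Finset.sum_product, mul_assoc]
        congr 1
        have hprod : (∑ d ∈ Finset.range (T + 1), (1 / 2 : ℝ) ^ d) ^ (q + 1) =
            ∑ d ∈ Fintype.piFinset (fun _ : Fin (q + 1) => Finset.range (T + 1)),
              ∏ j, (1 / 2 : ℝ) ^ d j := by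
          rw [← Finset.prod_univ_sum, Finset.prod_const, Finset.card_univ, Fintype.card_fin]
        rw [hprod, Finset.sum_mul_sum]
    _ ≤ K * (2 * 2 ^ (N * T)) * 2 ^ (q + 1) := by
        gcongr
        · exact sum_range_two_pow_mul_le hN T
        · exact sum_geometric_two_le _

/-- Covering by `k`-planes, for `k < n`: a point of height at most `M` lies in the plane orthogonal
to the first `n - k` successive minima of its lattice of relations. -/
theorem exists_planes_cover_nat (k q : ℕ) {M : ℕ} (hM : 1 ≤ M) :
    ∃ S : Finset (Projectivization.Subspace ℚ (Fin (k + (q + 1) + 1) → ℚ)),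
      (∀ L ∈ S, IsPlane k L) ∧
      (∃ T : ℕ, 2 ^ ((k + (q + 1)) * T) ≤
          (3 * (k + (q + 1) + 1) * M * 2 ^ q ^ 2) ^ (q + 1) ∧
        (S.card : ℝ) ≤ 2 ^ (3 * (k + (q + 1) + 1) * (q + 1)) *
          (2 * 2 ^ ((k + (q + 1) + 1) * T)) * 2 ^ (q + 1)) ∧
      ∀ P ∈ pointsOfHeightLE (k + (q + 1)) M, ∃ L ∈ S, P ∈ L := by
  classical
  set n := k + (q + 1) with hn
  set H := (3 * (n + 1) * M * 2 ^ q ^ 2) ^ (q + 1) with hH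
  have hH0 : H ≠ 0 := by positivity
  -- The largest `T` with `2 ^ (n * T) ≤ H`.
  set T := Nat.log 2 H / n with hT
  have hn0 : 0 < n := by omega
  refine ⟨(spansOfTotalSize (n + 1) q T).image orthogonalPlane, ?_, ⟨T, ?_, ?_⟩, ?_⟩
  · intro L hL
    obtain ⟨W, hW, rfl⟩ := Finset.mem_image.1 hL
    exact isPlane_orthogonalPlane (finrank_of_mem_spansOfTotalSize hW)
  · exact (Nat.pow_le_pow_right (by norm_num) (Nat.mul_div_le _ _)).trans
      (Nat.pow_log_le_self 2 hH0)
  · refine le_trans ?_ (card_spansOfTotalSize_le (Nat.le_add_left 1 n) q T)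
    exact_mod_cast Finset.card_image_le
  · rintro P ⟨x, hx0, rfl, hx⟩
    have hx : ∀ i, |x i| ≤ M := fun i => by exact_mod_cast hx i
    have hq : q < n := by omega
    obtain ⟨b, hli, hb⟩ := exists_linearIndependent_relations hM hx (q + 1) hq
    refine ⟨_, Finset.mem_image_of_mem _ (mem_spansOfTotalSize (f := fun j : Fin (q + 1) =>
      minimumExponent x j) ?_ ?_ ⟨b, hli, fun j => ?_, rfl⟩), ?_⟩
    · intro i j hij
      exact minimumExponent_le hij (by omega) hM hx
    · rw [Fin.sum_univ_eq_sum_range (fun j => minimumExponent x j), hT, Nat.le_div_iff_mul_le hn0,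
        mul_comm]
      exact Nat.le_log_of_pow_le (by norm_num) (two_pow_sum_minimumExponent_le hq hM hx)
    · exact mem_dyadicBox.2 (mem_relationBox.1 (hb j)).1
    · rw [mk_mem_orthogonalPlane]
      intro w hw
      induction hw using Submodule.span_induction with
      | mem w hw =>
        obtain ⟨j, rfl⟩ := hw
        have h := (mem_relationBox.1 (hb j)).2
        rw [dotProduct_comm]
        have h' : ((x ⬝ᵥ b j : ℤ) : ℚ) = 0 := by rw [h, Int.cast_zero]
        simpa [dotProduct, ratVec_apply] using h'
      | zero => simp
      | add v w _ _ h1 h2 => rw [add_dotProduct, h1, h2, add_zero]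
      | smul c v _ h => rw [smul_dotProduct, h, smul_zero]

theorem exists_planes_cover (n k : ℕ) (hn : 1 ≤ n) (hk : k ≤ n) :
    ∃ c : ℝ, 0 < c ∧ ∀ B : ℝ, 0 < B →
      ∃ S : Finset (Projectivization.Subspace ℚ (Fin (n + 1) → ℚ)),
        (∀ L ∈ S, IsPlane k L) ∧
        (S.card : ℝ) ≤ c * B ^ (((n : ℝ) + 1) * ((n : ℝ) - (k : ℝ)) / (n : ℝ)) ∧
        ∀ P ∈ pointsOfHeightLE n B, ∃ L ∈ S, P ∈ L := by
  rcases hk.eq_or_lt with rfl | hk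
  · refine ⟨1, one_pos, fun B hB => ⟨{⊤}, ?_, ?_, ?_⟩⟩
    · intro L hL
      rw [Finset.mem_singleton.1 hL, IsPlane, map_top, finrank_top, Module.finrank_fin_fun]
    · simp
    · intro P _
      refine ⟨⊤, Finset.mem_singleton_self _, ?_⟩
      induction P using Projectivization.ind with
      | h v hv =>
        rw [← Projectivization.Subspace.mem_submodule_iff _ hv, map_top]
        trivial
  obtain ⟨q, rfl⟩ : ∃ q, n = k + (q + 1) := ⟨n - k - 1, by omega⟩
  set n := k + (q + 1) with hn'
  have hnR : (0 : ℝ) < n := by exact_mod_cast hn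
  set E : ℝ := ((n : ℝ) + 1) * ((n : ℝ) - (k : ℝ)) / (n : ℝ) with hE
  set K : ℝ := 3 * (n + 1) * 2 ^ q ^ 2 with hK
  refine ⟨2 ^ (3 * (n + 1) * (q + 1)) * (2 * K ^ E) * 2 ^ (q + 1), by positivity, fun B hB => ?_⟩
  rcases lt_or_ge B 1 with hB1 | hB1
  · -- Below height `1` there are no points at all.
    refine ⟨∅, by simp, by simp; positivity, ?_⟩
    rintro P ⟨x, hx0, rfl, hx⟩
    exfalso
    apply hx0
    funext i
    have h1 : |(x i : ℝ)| < 1 := (hx i).trans_lt hB1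
    have h2 : |x i| < 1 := by exact_mod_cast h1
    rw [Int.abs_lt_one_iff.1 h2]
    simp
  have hM : 1 ≤ ⌊B⌋₊ := Nat.one_le_floor_iff _ |>.2 hB1
  obtain ⟨S, hS, ⟨T, hT, hcard⟩, hcov⟩ := exists_planes_cover_nat k q hM
  refine ⟨S, hS, hcard.trans ?_, ?_⟩
  · have hTR : (2 : ℝ) ^ (n * T) ≤ (K * B) ^ (q + 1) := by
      calc (2 : ℝ) ^ (n * T) ≤ (3 * (n + 1) * (⌊B⌋₊ : ℝ) * 2 ^ q ^ 2) ^ (q + 1) := by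
            exact_mod_cast hT
        _ ≤ (3 * (n + 1) * B * 2 ^ q ^ 2) ^ (q + 1) := by
            gcongr
            exact Nat.floor_le hB.le
        _ = _ := by rw [hK]; ring
    have hpow : (2 : ℝ) ^ ((n + 1) * T) ≤ (K * B) ^ E := by
      calc (2 : ℝ) ^ ((n + 1) * T) = ((2 : ℝ) ^ (n * T)) ^ (((n : ℝ) + 1) / n) := by
            rw [← Real.rpow_natCast, ← Real.rpow_natCast, ← Real.rpow_mul (by norm_num)]
            congr 1
            push_cast
            field_simp
        _ ≤ ((K * B) ^ (q + 1)) ^ (((n : ℝ) + 1) / n) :=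
            Real.rpow_le_rpow (by positivity) hTR (by positivity)
        _ = (K * B) ^ E := by
            rw [← Real.rpow_natCast, ← Real.rpow_mul (by positivity)]
            congr 1
            rw [hE, hn']
            push_cast
            ring
    rw [Real.mul_rpow (by positivity) hB.le] at hpow
    calc _ ≤ (2 : ℝ) ^ (3 * (n + 1) * (q + 1)) * (2 * (K ^ E * B ^ E)) * 2 ^ (q + 1) := by
          gcongr
      _ = _ := by ring
  · rintro P ⟨x, hx0, rfl, hx⟩
    refine hcov _ ⟨x, hx0, rfl, fun i => ?_⟩
    have h1 : |x i| ≤ ⌊B⌋ := Int.le_floor.2 (by exact_mod_cast hx i)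
    have h2 : ((⌊B⌋₊ : ℕ) : ℤ) = ⌊B⌋ := Int.natCast_floor_eq_floor hB.le
    rw [← h2] at h1
    exact_mod_cast h1

/-! ### Counting points of bounded height -/

theorem pointsOfHeightLE_finite (n : ℕ) (B : ℝ) : (pointsOfHeightLE n B).Finite := by
  let Z := {x : Fintype.piFinset fun _ : Fin (n + 1) => Finset.Icc (-⌊B⌋) ⌊B⌋ //
    (fun i => ((x : Fin (n + 1) → ℤ) i : ℚ)) ≠ 0}
  apply (Set.finite_range fun x : Z => Projectivization.mk ℚ _ x.2).subset
  rintro P ⟨x, hx0, rfl, hx⟩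
  refine ⟨⟨⟨x, Fintype.mem_piFinset.2 fun i => ?_⟩, hx0⟩, rfl⟩
  rw [Finset.mem_Icc, ← abs_le]
  exact Int.le_floor.2 (by exact_mod_cast hx i)

theorem sum_Ico_inv_sq_le (j : ℕ) :
    ∑ d ∈ Finset.Ico 2 (j + 3), ((d : ℝ) ^ 2)⁻¹ ≤ 3 / 4 - 1 / (j + 2) := by
  induction j with
  | zero => norm_num
  | succ j ih =>
    rw [show j + 1 + 3 = (j + 3) + 1 from rfl, Finset.sum_Ico_succ_top (by omega)]
    have h : ((((j + 3 : ℕ) : ℝ)) ^ 2)⁻¹ ≤ 1 / ((j : ℝ) + 2) - 1 / ((j : ℝ) + 3) := by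
      push_cast
      rw [div_sub_div _ _ (by positivity) (by positivity), inv_eq_one_div,
        div_le_div_iff₀ (by positivity) (by positivity)]
      nlinarith
    push_cast at h ⊢
    have h2 : (j : ℝ) + 1 + 2 = j + 3 := by ring
    rw [h2]
    linarith

/-- At least a quarter of the pairs in `[1, N] × [1, N]` are coprime, because
`∑ 1 / d ^ 2 ≤ 3 / 4` over `d ≥ 2`. -/
theorem sq_le_four_mul_card_coprime (N : ℕ) :
    N ^ 2 ≤ 4 * ((Finset.Ioc 0 N ×ˢ Finset.Ioc 0 N).filter fun p => p.1.Coprime p.2).card := by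
  set Q := Finset.Ioc 0 N ×ˢ Finset.Ioc 0 N
  have hQ : Q.card = N ^ 2 := by simp [Q, sq]
  have hsplit := Finset.card_filter_add_card_filter_not (s := Q) fun p => p.1.Coprime p.2
  -- A pair that is not coprime consists of multiples of its greatest common divisor `d ≥ 2`.
  have hsub : (Q.filter fun p => ¬ p.1.Coprime p.2) ⊆ (Finset.Ico 2 (N + 3)).biUnion fun d =>
      (Finset.Ioc 0 N).filter (d ∣ ·) ×ˢ (Finset.Ioc 0 N).filter (d ∣ ·) := by
    rintro ⟨a, b⟩ hab
    obtain ⟨habQ, hab⟩ := Finset.mem_filter.1 hab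
    obtain ⟨ha, hb⟩ := Finset.mem_product.1 habQ
    have ha' := Finset.mem_Ioc.1 ha
    have hg : 0 < a.gcd b := Nat.gcd_pos_of_pos_left _ ha'.1
    have hg' : a.gcd b ≤ a := Nat.gcd_le_left _ ha'.1
    have hg1 : a.gcd b ≠ 1 := hab
    simp only at ha'
    refine Finset.mem_biUnion.2 ⟨a.gcd b, Finset.mem_Ico.2 ⟨by omega, by omega⟩,
      Finset.mem_product.2 ⟨Finset.mem_filter.2 ⟨ha, Nat.gcd_dvd_left _ _⟩,
        Finset.mem_filter.2 ⟨hb, Nat.gcd_dvd_right _ _⟩⟩⟩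
  have hcard : (Q.filter fun p => ¬ p.1.Coprime p.2).card ≤
      ∑ d ∈ Finset.Ico 2 (N + 3), (N / d) ^ 2 := by
    refine (Finset.card_le_card hsub).trans (Finset.card_biUnion_le.trans ?_)
    apply Finset.sum_le_sum
    intro d _
    rw [Finset.card_product, Nat.Ioc_filter_dvd_card_eq_div, sq]
  have hreal : ((∑ d ∈ Finset.Ico 2 (N + 3), (N / d) ^ 2 : ℕ) : ℝ) ≤ 3 / 4 * N ^ 2 := by
    push_cast
    calc ∑ d ∈ Finset.Ico 2 (N + 3), (((N / d : ℕ) : ℝ)) ^ 2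
        ≤ ∑ d ∈ Finset.Ico 2 (N + 3), (N : ℝ) ^ 2 * ((d : ℝ) ^ 2)⁻¹ := by
          apply Finset.sum_le_sum
          intro d _
          rw [← div_eq_mul_inv, ← div_pow]
          gcongr
          exact Nat.cast_div_le
      _ = (N : ℝ) ^ 2 * ∑ d ∈ Finset.Ico 2 (N + 3), ((d : ℝ) ^ 2)⁻¹ := by rw [Finset.mul_sum]
      _ ≤ (N : ℝ) ^ 2 * (3 / 4) := by
          have := sum_Ico_inv_sq_le N
          have h2 : (0 : ℝ) < 1 / ((N : ℝ) + 2) := by positivity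
          gcongr
          linarith
      _ = _ := by ring
  have h1 : (((Q.filter fun p => ¬ p.1.Coprime p.2).card : ℕ) : ℝ) ≤ 3 / 4 * N ^ 2 :=
    (Nat.cast_le.2 hcard).trans hreal
  rw [hQ] at hsplit
  have h2 : (((Q.filter fun p => p.1.Coprime p.2).card : ℕ) : ℝ) +
      ((Q.filter fun p => ¬ p.1.Coprime p.2).card : ℕ) = (N : ℝ) ^ 2 := by exact_mod_cast hsplit
  have h3 : (N : ℝ) ^ 2 ≤ 4 * ((Q.filter fun p => p.1.Coprime p.2).card : ℕ) := by linarith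
  exact_mod_cast h3

/-- Vectors of positive integers whose first two coordinates are coprime represent distinct
points. -/
theorem pow_le_four_mul_ncard_pointsOfHeightLE {n : ℕ} (hn : 1 ≤ n) (N : ℕ) :
    N ^ (n + 1) ≤ 4 * (pointsOfHeightLE n (N : ℝ)).ncard := by
  obtain ⟨m, rfl⟩ : ∃ m, n = m + 1 := ⟨n - 1, by omega⟩
  set C := (Finset.Ioc 0 N ×ˢ Finset.Ioc 0 N).filter fun p => p.1.Coprime p.2 with hC
  set R := C ×ˢ Fintype.piFinset fun _ : Fin m => Finset.Ioc 0 N with hR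
  have hRcard : R.card = C.card * N ^ m := by simp [R]
  let vec : (ℕ × ℕ) × (Fin m → ℕ) → Fin (m + 1 + 1) → ℤ := fun z =>
    Fin.cons (z.1.1 : ℤ) (Fin.cons (z.1.2 : ℤ) fun i => (z.2 i : ℤ))
  have hmem : ∀ z ∈ R, (0 < z.1.1 ∧ z.1.1 ≤ N) ∧ (0 < z.1.2 ∧ z.1.2 ≤ N) ∧
      z.1.1.Coprime z.1.2 ∧ ∀ i, z.2 i ≤ N := by
    intro z hz
    simp only [R, C, Finset.mem_product, Finset.mem_filter, Finset.mem_Ioc,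
      Fintype.mem_piFinset] at hz
    exact ⟨hz.1.1.1, hz.1.1.2, hz.1.2, fun i => (hz.2 i).2⟩
  have hne : ∀ z ∈ R, (fun i => (vec z i : ℚ)) ≠ 0 := by
    intro z hz h0
    have := congrFun h0 0
    simp only [vec, Fin.cons_zero, Pi.zero_apply, Int.cast_natCast, Nat.cast_eq_zero] at this
    have := (hmem z hz).1
    omega
  let f : R → pointsOfHeightLE (m + 1) (N : ℝ) := fun z =>
    ⟨Projectivization.mk ℚ _ (hne z z.2), vec z, hne z z.2, rfl, by
      obtain ⟨h1, h2, -, h3⟩ := hmem z z.2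
      intro i
      refine Fin.cases ?_ (fun i => Fin.cases ?_ (fun i => ?_) i) i
      · simpa [vec] using h1.2
      · simpa [vec] using h2.2
      · simpa [vec] using h3 i⟩
  have hf : Function.Injective f := by
    rintro ⟨⟨⟨a, b⟩, u⟩, hz⟩ ⟨⟨⟨a', b'⟩, u'⟩, hz'⟩ h
    obtain ⟨t, ht⟩ := (Projectivization.mk_eq_mk_iff' ℚ _ _ _ _).1 (congrArg Subtype.val h)
    obtain ⟨ha, hb, hab, -⟩ := hmem _ hz
    obtain ⟨ha', hb', hab', -⟩ := hmem _ hz'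
    simp only at ha hb hab ha' hb' hab'
    have e0 : t * (a' : ℚ) = a := by simpa [vec] using congrFun ht 0
    have e1 : t * (b' : ℚ) = b := by simpa [vec] using congrFun ht 1
    have e2 : ∀ i, t * (u' i : ℚ) = u i := fun i => by
      simpa [vec] using congrFun ht i.succ.succ
    have hcross : a * b' = a' * b := by
      have : (a : ℚ) * b' = a' * b := by rw [← e0, ← e1]; ring
      exact_mod_cast this
    have haa : a = a' := by
      apply Nat.dvd_antisymm
      · exact hab.dvd_of_dvd_mul_right (hcross ▸ Dvd.intro _ rfl)
      · exact hab'.dvd_of_dvd_mul_right (hcross.symm ▸ Dvd.intro _ rfl)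
    subst haa
    have ha0 : (a : ℚ) ≠ 0 := by
      have := ha.1
      positivity
    have ht1 : t = 1 := by
      apply mul_right_cancel₀ ha0
      rw [e0, one_mul]
    subst ht1
    have hbb : b = b' := by
      rw [one_mul] at e1
      exact_mod_cast e1.symm
    have huu : u = u' := by
      funext i
      have := e2 i
      rw [one_mul] at this
      exact_mod_cast this.symm
    subst hbb huu
    rfl
  have hle : R.card ≤ (pointsOfHeightLE (m + 1) (N : ℝ)).ncard := by
    have := (pointsOfHeightLE_finite (m + 1) (N : ℝ)).to_subtype
    have h := Nat.card_le_card_of_injective f hf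
    rwa [Nat.card_eq_fintype_card, Fintype.card_coe, Nat.card_coe_set_eq] at h
  calc N ^ (m + 1 + 1) = N ^ 2 * N ^ m := by ring
    _ ≤ 4 * C.card * N ^ m := Nat.mul_le_mul_right _ (sq_le_four_mul_card_coprime N)
    _ = 4 * R.card := by rw [hRcard]; ring
    _ ≤ _ := Nat.mul_le_mul_left _ hle

/-! ### Optimality of the exponent -/

/-- The planes that cover all points of height at most `B` are so few that a bound with a smaller
power of their number would contradict the count of all these points. -/
theorem exists_planes_many_points (n k : ℕ) (hn : 1 ≤ n) (hk : k < n) (α : ℝ)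
    (hα : α < (n : ℝ) / ((n : ℝ) + 1)) (c : ℝ) :
    ∃ B : ℝ, 1 ≤ B ∧ ∃ S : Finset (Projectivization.Subspace ℚ (Fin (n + 1) → ℚ)),
      S.Nonempty ∧ (∀ L ∈ S, IsPlane k L) ∧
      c * (S.card : ℝ) ^ α * B ^ (k + 1) <
        ({P | P ∈ pointsOfHeightLE n B ∧ ∃ L ∈ S, P ∈ L}.ncard : ℝ) := by
  obtain ⟨c₁, hc₁, hcov⟩ := exists_planes_cover n k hn hk.le
  have hnR : (0 : ℝ) < n := by exact_mod_cast hn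
  have hkR : (0 : ℝ) < (n : ℝ) - k := by
    rw [sub_pos]
    exact_mod_cast hk
  set E : ℝ := ((n : ℝ) + 1) * ((n : ℝ) - (k : ℝ)) / (n : ℝ) with hE
  -- For `α < 0` the upper bound for the number of planes cannot be raised to the power `α`.
  set β := max α 0 with hβ
  have hβ0 : 0 ≤ β := le_max_right _ _
  have hβn : β < (n : ℝ) / ((n : ℝ) + 1) := max_lt hα (by positivity)
  set δ : ℝ := (n - k) - E * β with hδ
  have hδ0 : 0 < δ := by
    have hE0 : 0 < E := by positivity
    have h1 := mul_lt_mul_of_pos_left hβn hE0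
    have h2 : E * ((n : ℝ) / ((n : ℝ) + 1)) = n - k := by
      rw [hE]
      field_simp
    rw [h2] at h1
    linarith
  obtain ⟨N, hN1, hN⟩ : ∃ N : ℕ, 1 ≤ N ∧ 4 * (|c| * c₁ ^ β) < (N : ℝ) ^ δ :=
    ((Filter.eventually_ge_atTop 1).and (((tendsto_rpow_atTop hδ0).comp
      tendsto_natCast_atTop_atTop).eventually_gt_atTop _)).exists
  have hNR : (0 : ℝ) < N := by exact_mod_cast hN1
  obtain ⟨S, hS, hcard, hSP⟩ := hcov N hNR
  have hcount : (N : ℝ) ^ (n + 1) ≤ 4 * ((pointsOfHeightLE n (N : ℝ)).ncard : ℝ) := by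
    exact_mod_cast pow_le_four_mul_ncard_pointsOfHeightLE hn N
  have hall : {P | P ∈ pointsOfHeightLE n (N : ℝ) ∧ ∃ L ∈ S, P ∈ L} =
      pointsOfHeightLE n (N : ℝ) := by
    ext P
    exact ⟨fun h => h.1, fun h => ⟨h, hSP P h⟩⟩
  have hSne : S.Nonempty := by
    have hpos : 0 < (pointsOfHeightLE n (N : ℝ)).ncard := by
      have : (0 : ℝ) < (N : ℝ) ^ (n + 1) := by positivity
      have h2 : (0 : ℝ) < ((pointsOfHeightLE n (N : ℝ)).ncard : ℝ) := by linarith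
      exact_mod_cast h2
    obtain ⟨P, hP⟩ := Set.nonempty_of_ncard_ne_zero hpos.ne'
    obtain ⟨L, hL, -⟩ := hSP P hP
    exact ⟨L, hL⟩
  refine ⟨N, by exact_mod_cast hN1, S, hSne, hS, ?_⟩
  rw [hall]
  have hS1 : (1 : ℝ) ≤ S.card := by exact_mod_cast hSne.card_pos
  have hSα : (S.card : ℝ) ^ α ≤ c₁ ^ β * (N : ℝ) ^ (E * β) := by
    calc (S.card : ℝ) ^ α ≤ (S.card : ℝ) ^ β :=
          Real.rpow_le_rpow_of_exponent_le hS1 (le_max_left _ _)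
      _ ≤ (c₁ * (N : ℝ) ^ E) ^ β := Real.rpow_le_rpow (by positivity) hcard hβ0
      _ = _ := by rw [Real.mul_rpow hc₁.le (by positivity), ← Real.rpow_mul hNR.le]
  have hsplit : (N : ℝ) ^ δ * ((N : ℝ) ^ (E * β) * (N : ℝ) ^ (k + 1)) = (N : ℝ) ^ (n + 1) := by
    rw [← Real.rpow_natCast, ← Real.rpow_natCast, ← Real.rpow_add hNR, ← Real.rpow_add hNR]
    congr 1
    rw [hδ]
    push_cast
    ring
  have hpos : 0 < (N : ℝ) ^ (E * β) * (N : ℝ) ^ (k + 1) := by positivity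
  calc c * (S.card : ℝ) ^ α * (N : ℝ) ^ (k + 1)
      ≤ |c| * (c₁ ^ β * (N : ℝ) ^ (E * β)) * (N : ℝ) ^ (k + 1) := by
        gcongr
        exact le_abs_self c
    _ = |c| * c₁ ^ β * ((N : ℝ) ^ (E * β) * (N : ℝ) ^ (k + 1)) := by ring
    _ < (N : ℝ) ^ δ / 4 * ((N : ℝ) ^ (E * β) * (N : ℝ) ^ (k + 1)) :=
        mul_lt_mul_of_pos_right (by linarith) hpos
    _ = (N : ℝ) ^ (n + 1) / 4 := by rw [← hsplit]; ring
    _ ≤ _ := by linarith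

theorem mainTheorem5 (n k : ℕ) (hn : 1 ≤ n) (hk : k ≤ n) :
    (∃ c : ℝ, 0 < c ∧ ∀ B : ℝ, 0 < B →
      ∃ S : Finset (Projectivization.Subspace ℚ (Fin (n + 1) → ℚ)),
        (∀ L ∈ S, IsPlane k L) ∧
        (S.card : ℝ) ≤ c * B ^ (((n : ℝ) + 1) * ((n : ℝ) - (k : ℝ)) / (n : ℝ)) ∧
        ∀ P ∈ pointsOfHeightLE n B, ∃ L ∈ S, P ∈ L) ∧
    (k < n → ∀ α : ℝ, α < (n : ℝ) / ((n : ℝ) + 1) → ∀ c : ℝ,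
      ∃ B : ℝ, 1 ≤ B ∧
        ∃ S : Finset (Projectivization.Subspace ℚ (Fin (n + 1) → ℚ)),
          S.Nonempty ∧ (∀ L ∈ S, IsPlane k L) ∧
          c * (S.card : ℝ) ^ α * B ^ (k + 1) <
            ({P | P ∈ pointsOfHeightLE n B ∧ ∃ L ∈ S, P ∈ L}.ncard : ℝ)) :=
  ⟨exists_planes_cover n k hn hk, fun hkn α hα c => exists_planes_many_points n k hn hkn α hα c⟩
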